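/- Let $K\ge 1$, let $U_1,\dots,U_K$ be real random variables each taking finitely many values, let $Z_1,\dots,Z_K$ be standard Gaussian random variables, and assume that $U_k$ and $Z_k$ are independent for each $k$ and that the pairs $(U_1,Z_1),\dots,(U_K,Z_K)$ are independent. For $\sigma>0$ put $S_k=U_k+\sigma Z_k$, and let $\mathbf U$, $\mathbf S$ be the column vectors with components $U_k$, $S_k$. Let $\mathcal S=\{\mathbf w\in\mathbb R^K:\|\mathbf w\|=1\}$ be the unit sphere of row vectors. For a real random variable $Y$ with density $p_Y$ let $H(Y)=-\int_{\mathbb R} p_Y(y)\log p_Y(y)\,dy$ be its differential entropy; $H(\mathbf w\mathbf S)$ is well defined (the integral converges absolutely) for every $\mathbf w\in\mathcal S$ and $\sigma>0$. Let $\mathcal U$ be the set of values that $\mathbf U$ takes with positive probability, and let $\mathbf w^*\in\mathcal S$ be such that there exist $r\ge 1$ disjoint subsets $\mathcal U_1,\dots,\mathcal U_r$ of $\mathcal U$, each containing at least two elements, for which the linear subspace $V$ spanned by the vectors $\mathbf u-\mathbf u_i$, $\mathbf u\in\mathcal U_i\setminus\{\mathbf u_i\}$, $i=1,\dots,r$ (where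 $\mathbf u_i\in\mathcal U_i$ is arbitrary; $V$ does not depend on this choice) has dimension $K-1$ and is orthogonal to $\mathbf w^*$. Then for all sufficiently small $\sigma>0$ the function $\mathbf w\mapsto H(\mathbf w\mathbf S)$ on $\mathcal S$ has a local minimum point $\mathbf m_\sigma$, and these can be chosen so that $\mathbf m_\sigma\to\mathbf w^*$ as $\sigma\to0^+$. In particular, mixing (spurious) local entropy minima exist: if $K\ge2$ and every $U_k$ takes at least two distinct values with positive probability, then there is such a vector $\mathbf w^*$ which is mixing, i.e. not proportional to any row of the $K\times K$ identity matrix, and for all sufficiently small $\sigma>0$ the local minimum points $\mathbf m_\sigma\to\mathbf w^*$ can be chosen mixing as well. -/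

import Mathlib

open MeasureTheory ProbabilityTheory Filter
open scoped Topology

noncomputable section

/-- The set of distinct values that a discrete random variable (or random vector) `X` can take:
the points of positive probability. -/
def possibleValues {Ω α : Type*} [MeasurableSpace Ω] (P : Measure Ω) (X : Ω → α) : Set α :=
  {x | P (X ⁻¹' {x}) ≠ 0}

/-- `X` is a discrete random variable: almost surely it takes one of finitely many values. -/
def IsFinitelyDiscrete {Ω : Type*} [MeasurableSpace Ω] (P : Measure Ω) (X : Ω → ℝ) : Prop :=
  ∃ F : Finset ℝ, ∀ᵐ ω ∂P, X ω ∈ F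

/-- The probability density function of a real random variable `Y`. -/
def pdfReal {Ω : Type*} [MeasurableSpace Ω] (P : Measure Ω) (Y : Ω → ℝ) (y : ℝ) : ℝ :=
  ((P.map Y).rnDeriv volume y).toReal

/-- Shannon's differential entropy `H(Y) = -∫ p_Y(y) log p_Y(y) dy`. -/
def differentialEntropy {Ω : Type*} [MeasurableSpace Ω] (P : Measure Ω) (Y : Ω → ℝ) : ℝ :=
  -∫ y, pdfReal P Y y * Real.log (pdfReal P Y y)

/-- `Y` has a density and its differential entropy is a convergent integral. -/
def HasDifferentialEntropy {Ω : Type*} [MeasurableSpace Ω] (P : Measure Ω) (Y : Ω → ℝ) : Prop :=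
  AEMeasurable Y P ∧ P.map Y ≪ volume ∧
    Integrable (fun y => pdfReal P Y y * Real.log (pdfReal P Y y)) volume

/-- The random vector with components `U k`. -/
def randomVector {Ω : Type*} {K : ℕ} (U : Fin K → Ω → ℝ) (ω : Ω) : EuclideanSpace ℝ (Fin K) :=
  WithLp.toLp 2 (fun k => U k ω)

/-- The sources `S k = U k + σ Z k`. -/
def source {Ω : Type*} {K : ℕ} (U Z : Fin K → Ω → ℝ) (σ : ℝ) (k : Fin K) (ω : Ω) : ℝ :=
  U k ω + σ * Z k ω

/-- The output `wS`, product of the row vector `w` and the column vector `S`. -/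
def output {Ω : Type*} {K : ℕ} (S : Fin K → Ω → ℝ) (w : EuclideanSpace ℝ (Fin K)) (ω : Ω) : ℝ :=
  ∑ k, w k * S k ω

/-- The unit sphere of `ℝ^K`. -/
def unitSphere (K : ℕ) : Set (EuclideanSpace ℝ (Fin K)) := Metric.sphere 0 1

/-- The subspace spanned by the vectors `u - c i`, for `u ∈ C i` different from `c i`, over all
`i`. -/
def differenceSpan {K r : ℕ} (C : Fin r → Set (EuclideanSpace ℝ (Fin K)))
    (c : Fin r → EuclideanSpace ℝ (Fin K)) : Submodule ℝ (EuclideanSpace ℝ (Fin K)) :=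
  Submodule.span ℝ (⋃ i, (fun u => u - c i) '' (C i \ {c i}))

/-- The assumption on a vector `w`: it lies on the unit sphere and is orthogonal to a subspace of
dimension `K - 1` spanned by the differences within `r ≥ 1` disjoint sets, each made of at least
two possible values of the random vector `U`. -/
def IsOrthogonalToDifferences {Ω : Type*} [MeasurableSpace Ω] (P : Measure Ω) {K : ℕ}
    (U : Fin K → Ω → ℝ) (w : EuclideanSpace ℝ (Fin K)) : Prop :=
  ∃ (r : ℕ) (C : Fin r → Set (EuclideanSpace ℝ (Fin K))) (c : Fin r → EuclideanSpace ℝ (Fin K)),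
    1 ≤ r ∧
    (∀ i, C i ⊆ possibleValues P (randomVector U)) ∧
    (∀ i j, i ≠ j → Disjoint (C i) (C j)) ∧
    (∀ i, (C i).Nontrivial) ∧
    (∀ i, c i ∈ C i) ∧
    Module.finrank ℝ (differenceSpan C c) + 1 = K ∧
    w ∈ unitSphere K ∧
    ∀ v ∈ differenceSpan C c, inner ℝ w v = 0

/-- `w` is a local minimum point, on the unit sphere, of `w ↦ H(wS)` where `S = U + σ Z`. -/
def IsEntropyLocalMin {Ω : Type*} [MeasurableSpace Ω] (P : Measure Ω) {K : ℕ}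
    (U Z : Fin K → Ω → ℝ) (σ : ℝ) (w : EuclideanSpace ℝ (Fin K)) : Prop :=
  w ∈ unitSphere K ∧
    IsLocalMinOn (fun w' => differentialEntropy P (output (source U Z σ) w')) (unitSphere K) w

/-- `w` is mixing: it is not proportional to a row of the identity matrix. -/
def IsMixing {K : ℕ} (w : EuclideanSpace ℝ (Fin K)) : Prop :=
  ∀ (j : Fin K) (a : ℝ), w ≠ a • EuclideanSpace.single j (1 : ℝ)

end

/-! On the unit sphere the noise part of `wS` is `σ` times a standard Gaussian, so `wS` is a mixture
of laws `N(⟪w, u⟫, σ²)` whose weights `q u = P(U = u)` do not depend on `w`. Dividing the mixture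
density by that of its own component gives `H(wS) = C(σ) - mixtureLogRatio q (⟪w, u⟫ / σ)`, where
`C(σ)` does not depend on `w`. Minimising entropy is therefore maximising `mixtureLogRatio`.

For small `σ` this quantity is close to `∑ q i * log (weight of the components merged with i)`,
minus the discrete entropy of `wU`. The lower bound is exact and holds for every `σ`
(`sum_log_le_mixtureLogRatio`). The upper bound has an error exponentially small in `1 / σ²`
(`integral_log_mixtureRatio_le`).

Near `w*`, projections that differ at `w*` stay apart. If all projections that coincide at `w*` also
coincide at `w`, then `w` is orthogonal to `V`; as `V` is a hyperplane, `w = ±w*`. So every nearby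
`w ≠ w*` splits some merged pair, and by compactness it does so by a uniform `δ` when `dist w w* ≥
ε`. Splitting costs a fixed amount of `mixtureLogRatio`, which beats the error
(`eventually_mixtureLogRatio_lt`). Hence a minimiser of the entropy over a small ball around `w*` is
forced towards `w*`, and is a local minimum because it is interior. -/

/-! ### Expected log-density ratios of Gaussian mixtures -/

/-- The density at `x i + t` of the mixture of the laws `N(x j, 1)` with weights `q j`, relative to
the density of `N(x i, 1)`. -/
noncomputable def mixtureRatio {ι : Type*} [Fintype ι] (q x : ι → ℝ) (i : ι) (t : ℝ) : ℝ :=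
  ∑ j, q j * Real.exp (-(x i - x j) * t - (x i - x j) ^ 2 / 2)

/-- The expected logarithm of `mixtureRatio`; it is the opposite of the mutual information between
the component and the value of the mixture. -/
noncomputable def mixtureLogRatio {ι : Type*} [Fintype ι] (q x : ι → ℝ) : ℝ :=
  ∑ i, q i * ∫ t, Real.log (mixtureRatio q x i t) ∂gaussianReal 0 1

theorem integrable_exp_mul_add_gaussianReal (s c : ℝ) :
    Integrable (fun t => Real.exp (s * t + c)) (gaussianReal 0 1) := by
  simp_rw [Real.exp_add]
  exact (integrable_exp_mul_gaussianReal s).mul_const _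

theorem integral_exp_mul_add_gaussianReal (s c : ℝ) :
    ∫ t, Real.exp (s * t + c) ∂gaussianReal 0 1 = Real.exp (s ^ 2 / 2 + c) := by
  simp_rw [Real.exp_add]
  rw [integral_mul_const]
  have := congrFun (mgf_fun_id_gaussianReal (μ := 0) (v := 1)) s
  rw [mgf] at this
  rw [this]
  simp

theorem integrable_abs_gaussianReal : Integrable (fun t : ℝ => |t|) (gaussianReal 0 1) :=
  ((memLp_id_gaussianReal 1).integrable (by simp)).abs

section
variable {ι : Type*} [Fintype ι] {q x : ι → ℝ}

theorem continuous_mixtureRatio (i : ι) : Continuous (mixtureRatio q x i) := by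
  unfold mixtureRatio; fun_prop

/-- Components located exactly at `x i` have exponent zero for every `t`; the remaining terms are
positive and are dropped. -/
theorem sum_filter_le_mixtureRatio (hq : ∀ j, 0 < q j) (i : ι) (t : ℝ) :
    ∑ j with x i = x j, q j ≤ mixtureRatio q x i t := by
  classical
  calc ∑ j with x i = x j, q j
      = ∑ j with x i = x j, q j * Real.exp (-(x i - x j) * t - (x i - x j) ^ 2 / 2) := by
        refine Finset.sum_congr rfl fun j hj => ?_
        simp [(Finset.mem_filter.1 hj).2]
    _ ≤ _ := Finset.sum_le_sum_of_subset_of_nonneg (Finset.filter_subset _ _) fun j _ _ =>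
        mul_nonneg (hq j).le (Real.exp_pos _).le

theorem le_mixtureRatio (hq : ∀ j, 0 < q j) (i : ι) (t : ℝ) : q i ≤ mixtureRatio q x i t := by
  classical
  exact (Finset.single_le_sum (f := q) (fun j _ => (hq j).le) (by simp)).trans
    (sum_filter_le_mixtureRatio hq i t)

theorem mixtureRatio_pos (hq : ∀ j, 0 < q j) (i : ι) (t : ℝ) : 0 < mixtureRatio q x i t :=
  (hq i).trans_le (le_mixtureRatio hq i t)

theorem mixtureRatio_le (hq : ∀ j, 0 < q j) (hq1 : ∑ j, q j = 1) {D : ℝ} (i : ι)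
    (hD : ∀ j, |x i - x j| ≤ D) (t : ℝ) : mixtureRatio q x i t ≤ Real.exp (D * |t|) := by
  calc mixtureRatio q x i t ≤ ∑ j, q j * Real.exp (D * |t|) := by
        refine Finset.sum_le_sum fun j _ => mul_le_mul_of_nonneg_left
          (Real.exp_le_exp.2 ?_) (hq j).le
        have h1 : -(x i - x j) * t ≤ |x i - x j| * |t| := by
          rw [← abs_neg (x i - x j), ← abs_mul]; exact le_abs_self _
        have h2 := mul_le_mul_of_nonneg_right (hD j) (abs_nonneg t)
        have := sq_nonneg (x i - x j)
        linarith
    _ = _ := by rw [← Finset.sum_mul, hq1, one_mul]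

/-- The bound depends on `x` only through its spread `D`, so it serves as a dominating function when
`x` varies. -/
theorem abs_log_mixtureRatio_le (hq : ∀ j, 0 < q j) (hq1 : ∑ j, q j = 1) {D : ℝ} (i : ι)
    (hD : ∀ j, |x i - x j| ≤ D) (t : ℝ) :
    |Real.log (mixtureRatio q x i t)| ≤ |Real.log (q i)| + D * |t| := by
  have h1 := Real.log_le_log (hq i) (le_mixtureRatio (x := x) hq i t)
  have h2 := Real.log_le_log (mixtureRatio_pos hq i t) (mixtureRatio_le hq hq1 i hD t)
  rw [Real.log_exp] at h2
  have h3 := neg_abs_le (Real.log (q i))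
  have hD0 : 0 ≤ D := (abs_nonneg _).trans (hD i)
  have h4 := abs_nonneg (Real.log (q i))
  have h5 : 0 ≤ D * |t| := by positivity
  exact abs_le.2 ⟨by linarith, by linarith⟩

theorem integrable_log_mixtureRatio (hq : ∀ j, 0 < q j) (hq1 : ∑ j, q j = 1) (i : ι) :
    Integrable (fun t => Real.log (mixtureRatio q x i t)) (gaussianReal 0 1) := by
  refine ((integrable_const (|Real.log (q i)|)).add
    (integrable_abs_gaussianReal.const_mul (∑ j, |x i - x j|))).mono'
    (((continuous_mixtureRatio i).log fun t => (mixtureRatio_pos hq i t).ne').aestronglyMeasurable)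
    (ae_of_all _ fun t => ?_)
  exact abs_log_mixtureRatio_le hq hq1 i
    (fun j => Finset.single_le_sum (f := fun j => |x i - x j|) (fun _ _ => abs_nonneg _)
      (Finset.mem_univ j)) t

theorem continuousOn_mixtureLogRatio {X : Type*} [TopologicalSpace X] [FirstCountableTopology X]
    (hq : ∀ j, 0 < q j) (hq1 : ∑ j, q j = 1) {y : X → ι → ℝ} {s : Set X}
    (hy : ∀ j, ContinuousOn (fun w => y w j) s) {D : ℝ}
    (hD : ∀ w ∈ s, ∀ i j, |y w i - y w j| ≤ D) :
    ContinuousOn (fun w => mixtureLogRatio q (y w)) s := by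
  unfold mixtureLogRatio
  refine continuousOn_finsetSum _ fun i _ => continuousOn_const.mul ?_
  refine continuousOn_of_dominated (bound := fun t => |Real.log (q i)| + D * |t|)
    (fun w _ => (integrable_log_mixtureRatio hq hq1 i).aestronglyMeasurable)
    (fun w hw => ae_of_all _ fun t => abs_log_mixtureRatio_le hq hq1 i (hD w hw i) t)
    ((integrable_const _).add (integrable_abs_gaussianReal.const_mul D))
    (ae_of_all _ fun t => ?_)
  refine ContinuousOn.log ?_ fun w _ => (mixtureRatio_pos hq i t).ne'
  unfold mixtureRatio
  refine continuousOn_finsetSum _ fun j _ => continuousOn_const.mul ?_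
  have := (hy i).sub (hy j)
  exact Real.continuous_exp.comp_continuousOn
    ((this.neg.mul continuousOn_const).sub ((this.pow 2).div_const 2))

theorem log_sum_filter_le_integral_log_mixtureRatio (hq : ∀ j, 0 < q j) (hq1 : ∑ j, q j = 1)
    (i : ι) : Real.log (∑ j with x i = x j, q j) ≤
      ∫ t, Real.log (mixtureRatio q x i t) ∂gaussianReal 0 1 := by
  have h : ∫ _, Real.log (∑ j with x i = x j, q j) ∂gaussianReal 0 1 ≤
      ∫ t, Real.log (mixtureRatio q x i t) ∂gaussianReal 0 1 := by
    refine integral_mono (integrable_const _) (integrable_log_mixtureRatio hq hq1 i) fun t =>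
      Real.log_le_log ?_ (sum_filter_le_mixtureRatio hq i t)
    exact (hq i).trans_le (Finset.single_le_sum (f := q) (fun j _ => (hq j).le) (by simp))
  simpa using h

/-- This trades `c ^ 2` for `c` inside an expectation: each likelihood ratio has mean `1`, however
far its component, while its square root has an exponentially small mean. -/
theorem log_one_add_sum_sq_le {κ : Type*} (s : Finset κ) {c : κ → ℝ} (hc : ∀ j ∈ s, 0 ≤ c j) :
    Real.log (1 + ∑ j ∈ s, c j ^ 2) ≤ 2 * ∑ j ∈ s, c j := by
  have h0 : 0 ≤ ∑ j ∈ s, c j := Finset.sum_nonneg hc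
  have h1 : ∑ j ∈ s, c j ^ 2 ≤ (∑ j ∈ s, c j) ^ 2 :=
    Finset.sum_sq_le_sq_sum_of_nonneg hc
  have h2 : 0 ≤ ∑ j ∈ s, c j ^ 2 := Finset.sum_nonneg fun j _ => sq_nonneg _
  calc Real.log (1 + ∑ j ∈ s, c j ^ 2) ≤ Real.log ((1 + ∑ j ∈ s, c j) ^ 2) :=
        Real.log_le_log (by linarith) (by nlinarith)
    _ = 2 * Real.log (1 + ∑ j ∈ s, c j) := by rw [Real.log_pow]; norm_num
    _ ≤ _ := by
        have := Real.log_le_sub_one_of_pos (x := 1 + ∑ j ∈ s, c j) (by linarith)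
        linarith

/-- Factor out the part `A` of the ratio coming from `S`. Each likelihood ratio has mean `1`, so `A`
has mean `∑ j ∈ S, q j` and concavity of the logarithm bounds `E log A`. Since `A ≥ q i`, the other
components contribute at most `log (1 + ∑ c j ^ 2) ≤ 2 * ∑ c j`, where `c j` is the square root of a
weighted likelihood ratio. -/
theorem integral_log_mixtureRatio_le [DecidableEq ι] (hq : ∀ j, 0 < q j) (hq1 : ∑ j, q j = 1)
    (i : ι) (S : Finset ι) (hi : i ∈ S) :
    ∫ t, Real.log (mixtureRatio q x i t) ∂gaussianReal 0 1 ≤ Real.log (∑ j ∈ S, q j) +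
      2 * ∑ j ∈ Sᶜ, √(q j / q i) * Real.exp (-(x i - x j) ^ 2 / 8) := by
  set Q := ∑ j ∈ S, q j with hQdef
  have hQ : 0 < Q := (hq i).trans_le (Finset.single_le_sum (f := q) (fun j _ => (hq j).le) hi)
  set e : ι → ℝ → ℝ := fun j t => Real.exp (-(x i - x j) * t + -(x i - x j) ^ 2 / 2) with he
  set g : ι → ℝ → ℝ := fun j t => Real.exp (-(x i - x j) / 2 * t + -(x i - x j) ^ 2 / 4) with hg
  have hei : ∀ j, Integrable (e j) (gaussianReal 0 1) := fun j =>
    integrable_exp_mul_add_gaussianReal _ _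
  have hgi : ∀ j, Integrable (g j) (gaussianReal 0 1) := fun j =>
    integrable_exp_mul_add_gaussianReal _ _
  have hesum : ∀ j, ∫ t, e j t ∂gaussianReal 0 1 = 1 := fun j => by
    rw [he, integral_exp_mul_add_gaussianReal]
    rw [← Real.exp_zero]; congr 1; ring
  have hgsum : ∀ j, ∫ t, g j t ∂gaussianReal 0 1 = Real.exp (-(x i - x j) ^ 2 / 8) := fun j => by
    rw [hg, integral_exp_mul_add_gaussianReal]
    congr 1; ring
  have hpt : ∀ t, Real.log (mixtureRatio q x i t) ≤
      (Real.log Q - 1 + (∑ j ∈ S, q j * e j t) / Q) + 2 * ∑ j ∈ Sᶜ, √(q j / q i) * g j t := by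
    intro t
    set A := ∑ j ∈ S, q j * e j t with hA
    have hsplit : mixtureRatio q x i t = A + ∑ j ∈ Sᶜ, q j * e j t := by
      rw [hA, Finset.sum_add_sum_compl]
      refine Finset.sum_congr rfl fun j _ => ?_
      simp only [he]; congr 2; ring
    have hAi : q i ≤ A := by
      have := Finset.single_le_sum (f := fun j => q j * e j t)
        (fun j _ => mul_nonneg (hq j).le (Real.exp_pos _).le) hi
      rw [hA]; refine le_trans (le_of_eq ?_) this; simp [he]
    have hA0 : 0 < A := (hq i).trans_le hAi
    have h1 : mixtureRatio q x i t ≤ A * (1 + ∑ j ∈ Sᶜ, (√(q j / q i) * g j t) ^ 2) := by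
      have : ∑ j ∈ Sᶜ, q j * e j t = q i * ∑ j ∈ Sᶜ, (√(q j / q i) * g j t) ^ 2 := by
        rw [Finset.mul_sum]
        refine Finset.sum_congr rfl fun j _ => ?_
        rw [mul_pow, Real.sq_sqrt (div_pos (hq j) (hq i)).le]
        have : g j t ^ 2 = e j t := by
          simp only [he, hg]; rw [← Real.exp_nat_mul]; congr 1; push_cast; ring
        rw [this]; field_simp [(hq i).ne']
      rw [hsplit, this, mul_add, mul_one]
      have := mul_le_mul_of_nonneg_right hAi
        (Finset.sum_nonneg fun j (_ : j ∈ Sᶜ) => sq_nonneg (√(q j / q i) * g j t))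
      linarith
    have h2 : 0 ≤ ∑ j ∈ Sᶜ, (√(q j / q i) * g j t) ^ 2 :=
      Finset.sum_nonneg fun j _ => sq_nonneg _
    have h3 := Real.log_le_log (mixtureRatio_pos hq i t) h1
    rw [Real.log_mul hA0.ne' (by linarith)] at h3
    have h4 := log_one_add_sum_sq_le Sᶜ (c := fun j => √(q j / q i) * g j t)
      fun j _ => mul_nonneg (Real.sqrt_nonneg _) (Real.exp_pos _).le
    -- Jensen's inequality in pointwise form: the tangent line of `log` at `Q`, whose linear term
    -- integrates to `1`.
    have h5 := Real.log_le_sub_one_of_pos (div_pos hA0 hQ)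
    rw [Real.log_div hA0.ne' hQ.ne'] at h5
    linarith
  have hI1 : Integrable (fun t => ∑ j ∈ S, q j * e j t) (gaussianReal 0 1) :=
    integrable_finsetSum _ fun j _ => (hei j).const_mul _
  have hI2 : Integrable (fun t => ∑ j ∈ Sᶜ, √(q j / q i) * g j t) (gaussianReal 0 1) :=
    integrable_finsetSum _ fun j _ => (hgi j).const_mul _
  have hI3 : Integrable (fun t => Real.log Q - 1 + (∑ j ∈ S, q j * e j t) / Q)
    (gaussianReal 0 1) := (integrable_const _).add (hI1.div_const Q)
  refine (integral_mono (integrable_log_mixtureRatio hq hq1 i) (hI3.add (hI2.const_mul 2))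
    hpt).trans_eq ?_
  rw [integral_add' hI3 (hI2.const_mul 2), integral_add (integrable_const _) (hI1.div_const Q),
    integral_div, integral_const_mul, integral_finsetSum _ fun j _ => (hei j).const_mul _,
    integral_finsetSum _ fun j _ => (hgi j).const_mul _]
  simp_rw [integral_const_mul, hesum, hgsum, mul_one]
  rw [← hQdef, div_self hQ.ne']
  simp

end

/-! ### Differential entropy of a Gaussian mixture -/

section
variable {ι : Type*} [Fintype ι] {q a : ι → ℝ}

/-- The density of the mixture of the laws `N(a j, v)` with weights `q j`. -/
noncomputable def mixturePDF (q a : ι → ℝ) (v : NNReal) (y : ℝ) : ℝ :=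
  ∑ j, q j * gaussianPDFReal (a j) v y

theorem mixturePDF_nonneg (hq : ∀ j, 0 < q j) (v : NNReal) (y : ℝ) : 0 ≤ mixturePDF q a v y :=
  Finset.sum_nonneg fun j _ => mul_nonneg (hq j).le (gaussianPDFReal_nonneg _ _ _)

theorem measurable_mixturePDF (v : NNReal) : Measurable (mixturePDF q a v) := by
  unfold mixturePDF
  exact Finset.measurable_sum _ fun j _ => (measurable_gaussianPDFReal _ _).const_mul _

theorem sum_smul_gaussianReal_eq_withDensity (hq : ∀ j, 0 < q j) {v : NNReal} (hv : v ≠ 0) :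
    ∑ j, ENNReal.ofReal (q j) • gaussianReal (a j) v =
      volume.withDensity fun y => ENNReal.ofReal (mixturePDF q a v y) := by
  ext s hs
  rw [withDensity_apply _ hs, Measure.finsetSum_apply]
  have : ∀ y, ENNReal.ofReal (mixturePDF q a v y) =
      ∑ j, ENNReal.ofReal (q j) * gaussianPDF (a j) v y := fun y => by
    rw [mixturePDF, ENNReal.ofReal_sum_of_nonneg fun j _ =>
      mul_nonneg (hq j).le (gaussianPDFReal_nonneg _ _ _)]
    exact Finset.sum_congr rfl fun j _ => ENNReal.ofReal_mul (hq j).le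
  simp_rw [this]
  rw [lintegral_finsetSum _ fun j _ => (measurable_gaussianPDF _ _).const_mul _]
  refine Finset.sum_congr rfl fun j _ => ?_
  rw [lintegral_const_mul _ (measurable_gaussianPDF _ _), Measure.smul_apply,
    gaussianReal_apply _ hv, smul_eq_mul]

theorem mixturePDF_eq_mul_mixtureRatio {σ : ℝ} (hσ : 0 < σ) (i : ι) (t : ℝ) :
    mixturePDF q a (σ ^ 2).toNNReal (a i + σ * t) =
      (√(2 * Real.pi * σ ^ 2))⁻¹ * Real.exp (-t ^ 2 / 2) *
        mixtureRatio q (fun j => a j / σ) i t := by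
  rw [mixturePDF, mixtureRatio, Finset.mul_sum]
  refine Finset.sum_congr rfl fun j _ => ?_
  rw [gaussianPDFReal]
  rw [Real.coe_toNNReal _ (sq_nonneg σ)]
  rw [show -(a i + σ * t - a j) ^ 2 / (2 * σ ^ 2) =
    -t ^ 2 / 2 + (-(a i / σ - a j / σ) * t - (a i / σ - a j / σ) ^ 2 / 2) by field_simp; ring,
    Real.exp_add]
  ring

theorem gaussianReal_eq_map_std (c σ : ℝ) :
    gaussianReal c (σ ^ 2).toNNReal = (gaussianReal 0 1).map fun t => c + σ * t := by
  have h : (fun t : ℝ => c + σ * t) = (fun t => c + t) ∘ fun t => σ * t := rfl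
  rw [h, ← Measure.map_map (by fun_prop) (by fun_prop), gaussianReal_map_const_mul,
    gaussianReal_map_const_add]
  congr 1
  · simp
  · ext; simp [sq_nonneg]

theorem log_mixturePDF (hq : ∀ j, 0 < q j) {σ : ℝ} (hσ : 0 < σ) (i : ι) (t : ℝ) :
    Real.log (mixturePDF q a (σ ^ 2).toNNReal (a i + σ * t)) =
      -Real.log √(2 * Real.pi * σ ^ 2) - t ^ 2 / 2 +
        Real.log (mixtureRatio q (fun j => a j / σ) i t) := by
  have h1 : (√(2 * Real.pi * σ ^ 2))⁻¹ ≠ 0 := by positivity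
  rw [mixturePDF_eq_mul_mixtureRatio hσ, Real.log_mul (mul_ne_zero h1 (Real.exp_pos _).ne')
    (mixtureRatio_pos hq i t).ne', Real.log_mul h1 (Real.exp_pos _).ne', Real.log_inv,
    Real.log_exp]
  ring

theorem integrable_sq_gaussianReal : Integrable (fun t : ℝ => t ^ 2 / 2) (gaussianReal 0 1) :=
  ((memLp_id_gaussianReal 2).integrable_sq).div_const 2

theorem integrable_log_mixturePDF (hq : ∀ j, 0 < q j) (hq1 : ∑ j, q j = 1) {σ : ℝ} (hσ : 0 < σ)
    (i : ι) : Integrable (fun y => Real.log (mixturePDF q a (σ ^ 2).toNNReal y))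
      (gaussianReal (a i) (σ ^ 2).toNNReal) := by
  rw [gaussianReal_eq_map_std, integrable_map_measure
    (measurable_mixturePDF _).log.aestronglyMeasurable (by fun_prop)]
  refine Integrable.congr (((integrable_const _).sub integrable_sq_gaussianReal).add
    (integrable_log_mixtureRatio hq hq1 i)) (ae_of_all _ fun t => (log_mixturePDF hq hσ i t).symm)

theorem integral_log_mixturePDF (hq : ∀ j, 0 < q j) (hq1 : ∑ j, q j = 1) {σ : ℝ} (hσ : 0 < σ)
    (i : ι) : ∫ y, Real.log (mixturePDF q a (σ ^ 2).toNNReal y)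
      ∂gaussianReal (a i) (σ ^ 2).toNNReal =
      -Real.log √(2 * Real.pi * σ ^ 2) - ∫ t, t ^ 2 / 2 ∂gaussianReal 0 1 +
        ∫ t, Real.log (mixtureRatio q (fun j => a j / σ) i t) ∂gaussianReal 0 1 := by
  rw [gaussianReal_eq_map_std, integral_map (by fun_prop)
    (measurable_mixturePDF _).log.aestronglyMeasurable]
  simp_rw [log_mixturePDF hq hσ]
  have h := (integrable_const (μ := gaussianReal 0 1) (-Real.log √(2 * Real.pi * σ ^ 2))).sub
    integrable_sq_gaussianReal
  simp only [Pi.sub_def] at h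
  rw [integral_add h (integrable_log_mixtureRatio hq hq1 i), integral_sub (integrable_const _)
    integrable_sq_gaussianReal]
  simp

variable {Ω : Type*} [MeasurableSpace Ω] {P : Measure Ω} {Y : Ω → ℝ} {σ : ℝ}

theorem pdfReal_ae_eq_mixturePDF (hq : ∀ j, 0 < q j) {v : NNReal} (hv : v ≠ 0)
    (hlaw : P.map Y = ∑ j, ENNReal.ofReal (q j) • gaussianReal (a j) v) :
    pdfReal P Y =ᵐ[volume] mixturePDF q a v := by
  rw [sum_smul_gaussianReal_eq_withDensity hq hv] at hlaw
  have := Measure.rnDeriv_withDensity (ν := (volume : Measure ℝ))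
    (measurable_mixturePDF (q := q) (a := a) v).ennreal_ofReal
  filter_upwards [this] with y hy
  rw [pdfReal, hlaw, hy, ENNReal.toReal_ofReal (mixturePDF_nonneg hq v y)]

theorem integrable_mul_gaussianPDFReal_log (hq : ∀ j, 0 < q j) (hq1 : ∑ j, q j = 1) (hσ : 0 < σ)
    (i : ι) : Integrable (fun y => gaussianPDFReal (a i) (σ ^ 2).toNNReal y *
      Real.log (mixturePDF q a (σ ^ 2).toNNReal y)) volume := by
  have hv : (σ ^ 2).toNNReal ≠ 0 := (Real.toNNReal_pos.2 (pow_pos hσ 2)).ne'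
  have h := integrable_log_mixturePDF (a := a) hq hq1 hσ i
  rw [gaussianReal_of_var_ne_zero _ hv, integrable_withDensity_iff_integrable_smul'
    (measurable_gaussianPDF _ _) (ae_of_all _ fun y => gaussianPDF_lt_top)] at h
  simpa [toReal_gaussianPDF] using h

theorem mixturePDF_mul_log_eq (v : NNReal) (y : ℝ) :
    mixturePDF q a v y * Real.log (mixturePDF q a v y) =
      ∑ j, q j * (gaussianPDFReal (a j) v y * Real.log (mixturePDF q a v y)) := by
  nth_rewrite 1 [mixturePDF]
  rw [Finset.sum_mul]
  exact Finset.sum_congr rfl fun j _ => mul_assoc _ _ _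

theorem hasDifferentialEntropy_of_map_eq_sum_gaussianReal (hq : ∀ j, 0 < q j)
    (hq1 : ∑ j, q j = 1) (hσ : 0 < σ) (hY : AEMeasurable Y P)
    (hlaw : P.map Y = ∑ j, ENNReal.ofReal (q j) • gaussianReal (a j) (σ ^ 2).toNNReal) :
    HasDifferentialEntropy P Y := by
  have hv : (σ ^ 2).toNNReal ≠ 0 := (Real.toNNReal_pos.2 (pow_pos hσ 2)).ne'
  refine ⟨hY, ?_, ?_⟩
  · rw [hlaw, sum_smul_gaussianReal_eq_withDensity hq hv]
    exact withDensity_absolutelyContinuous _ _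
  · have h : Integrable (fun y => mixturePDF q a (σ ^ 2).toNNReal y *
        Real.log (mixturePDF q a (σ ^ 2).toNNReal y)) volume := by
      simp_rw [mixturePDF_mul_log_eq]
      exact integrable_finsetSum _ fun j _ =>
        (integrable_mul_gaussianPDFReal_log hq hq1 hσ j).const_mul _
    refine h.congr ?_
    filter_upwards [pdfReal_ae_eq_mixturePDF hq hv hlaw] with y hy
    rw [hy]

/-- Integrate `log` of the mixture density against each component separately, after centring and
rescaling it to `N(0, 1)`. The Gaussian factor of the density gives the terms free of `a`. -/
theorem differentialEntropy_of_map_eq_sum_gaussianReal (hq : ∀ j, 0 < q j)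
    (hq1 : ∑ j, q j = 1) (hσ : 0 < σ)
    (hlaw : P.map Y = ∑ j, ENNReal.ofReal (q j) • gaussianReal (a j) (σ ^ 2).toNNReal) :
    differentialEntropy P Y = Real.log √(2 * Real.pi * σ ^ 2) +
      ∫ t, t ^ 2 / 2 ∂gaussianReal 0 1 - mixtureLogRatio q fun j => a j / σ := by
  have hv : (σ ^ 2).toNNReal ≠ 0 := (Real.toNNReal_pos.2 (pow_pos hσ 2)).ne'
  have h1 : ∫ y, pdfReal P Y y * Real.log (pdfReal P Y y) =
      ∫ y, mixturePDF q a (σ ^ 2).toNNReal y *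
        Real.log (mixturePDF q a (σ ^ 2).toNNReal y) := by
    refine integral_congr_ae ?_
    filter_upwards [pdfReal_ae_eq_mixturePDF hq hv hlaw] with y hy
    rw [hy]
  rw [differentialEntropy, h1]
  simp_rw [mixturePDF_mul_log_eq]
  rw [integral_finsetSum _ fun j _ =>
    (integrable_mul_gaussianPDFReal_log hq hq1 hσ j).const_mul _]
  have h2 : ∀ j, ∫ y, q j * (gaussianPDFReal (a j) (σ ^ 2).toNNReal y *
      Real.log (mixturePDF q a (σ ^ 2).toNNReal y)) =
      q j * (-Real.log √(2 * Real.pi * σ ^ 2) - ∫ t, t ^ 2 / 2 ∂gaussianReal 0 1) +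
        q j * ∫ t, Real.log (mixtureRatio q (fun j => a j / σ) j t) ∂gaussianReal 0 1 := by
    intro j
    rw [integral_const_mul, ← mul_add, ← integral_log_mixturePDF hq hq1 hσ,
      integral_gaussianReal_eq_integral_smul hv]
    rfl
  simp_rw [h2]
  rw [Finset.sum_add_distrib, ← Finset.sum_mul, hq1, mixtureLogRatio]
  ring

end

/-! ### Law of the output -/

section
variable {Ω : Type*} [MeasurableSpace Ω] {P : Measure Ω}

theorem ae_mem_possibleValues {α : Type*} {X : Ω → α} {G : Set α} (hG : G.Finite)
    (hX : ∀ᵐ ω ∂P, X ω ∈ G) : ∀ᵐ ω ∂P, X ω ∈ possibleValues P X := by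
  have h : ∀ x ∈ G, ∀ᵐ ω ∂P, X ω = x → x ∈ possibleValues P X := fun x _ => by
    by_cases hx : x ∈ possibleValues P X
    · exact ae_of_all _ fun _ _ => hx
    · have : P (X ⁻¹' {x}) = 0 := not_not.1 hx
      filter_upwards [measure_eq_zero_iff_ae_notMem.1 this] with ω hω h
      exact (hω h).elim
  filter_upwards [hX, (ae_ball_iff hG.countable).2 h] with ω h1 h2
  exact h2 _ h1 rfl

theorem possibleValues_subset {α : Type*} {X : Ω → α} {G : Set α} (hX : ∀ᵐ ω ∂P, X ω ∈ G) :
    possibleValues P X ⊆ G := by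
  intro x hx
  by_contra h
  refine hx (measure_eq_zero_iff_ae_notMem.2 ?_)
  filter_upwards [hX] with ω hω h'
  rw [Set.mem_preimage, Set.mem_singleton_iff] at h'
  exact h (h' ▸ hω)

theorem measure_eq_sum_possibleValues {α : Type*} [MeasurableSpace α] [MeasurableSingletonClass α]
    {X : Ω → α} (hXm : Measurable X) [Fintype (possibleValues P X)]
    (hX : ∀ᵐ ω ∂P, X ω ∈ possibleValues P X) {B : Set Ω} (hB : MeasurableSet B) :
    P B = ∑ u : possibleValues P X, P (X ⁻¹' {(u : α)} ∩ B) := by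
  have hm : ∀ u : possibleValues P X, MeasurableSet (X ⁻¹' {(u : α)} ∩ B) := fun u =>
    (hXm (measurableSet_singleton _)).inter hB
  rw [← tsum_fintype (L := .unconditional _), ← measure_iUnion ?_ hm]
  · refine measure_congr ?_
    filter_upwards [hX] with ω hω
    refine propext ⟨fun h => Set.mem_iUnion.2 ⟨⟨_, hω⟩, rfl, h⟩, fun h => ?_⟩
    obtain ⟨_, -, h⟩ := Set.mem_iUnion.1 h
    exact h
  · intro u v huv
    refine Set.disjoint_left.2 fun ω h1 h2 => huv (Subtype.ext ?_)
    exact h1.1.symm.trans h2.1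

theorem sum_measureReal_possibleValues [IsProbabilityMeasure P] {α : Type*} [MeasurableSpace α]
    [MeasurableSingletonClass α] {X : Ω → α} (hXm : Measurable X) [Fintype (possibleValues P X)]
    (hX : ∀ᵐ ω ∂P, X ω ∈ possibleValues P X) :
    ∑ u : possibleValues P X, P.real (X ⁻¹' {(u : α)}) = 1 := by
  have := measure_eq_sum_possibleValues hXm hX (P := P) MeasurableSet.univ
  simp only [Set.inter_univ, measure_univ] at this
  simp only [Measure.real]
  rw [← ENNReal.toReal_sum fun _ _ => measure_ne_top _ _, ← this, ENNReal.toReal_one]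

/-- Split over the values of `X`: on `X = u` the variable is `f u + σ * N`, and independence factors
the probability. -/
theorem map_add_mul_eq_sum [IsProbabilityMeasure P] {α : Type*} [MeasurableSpace α]
    [MeasurableSingletonClass α] {X : Ω → α} (hXm : Measurable X) [Fintype (possibleValues P X)]
    (hX : ∀ᵐ ω ∂P, X ω ∈ possibleValues P X) {N : Ω → ℝ} (hN : Measurable N)
    (hXN : IndepFun X N P) {f : α → ℝ} (hf : Measurable f) (σ : ℝ) :
    P.map (fun ω => f (X ω) + σ * N ω) = ∑ u : possibleValues P X,
      ENNReal.ofReal (P.real (X ⁻¹' {(u : α)})) • (P.map N).map fun t => f u + σ * t := by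
  have hmeas : Measurable fun ω => f (X ω) + σ * N ω :=
    (hf.comp hXm).add (hN.const_mul σ)
  ext B hB
  rw [Measure.map_apply hmeas hB, measure_eq_sum_possibleValues hXm hX (hmeas hB),
    Measure.finsetSum_apply]
  refine Finset.sum_congr rfl fun u _ => ?_
  have hg : Measurable fun t : ℝ => f u + σ * t := by fun_prop
  rw [Measure.smul_apply, Measure.map_apply hg hB, Measure.map_apply hN (hg hB), smul_eq_mul,
    ofReal_measureReal,
    ← hXN.measure_inter_preimage_eq_mul _ _ (measurableSet_singleton _) (hg hB)]
  congr 1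
  ext ω
  simp only [Set.mem_inter_iff, Set.mem_preimage, Set.mem_singleton_iff]
  exact and_congr_right fun h => by rw [h]

/-- The joint law of the pairs is a product of products; regrouping the factors turns it into the
law of `U` times the law of `Z`. -/
theorem indepFun_pi_of_iIndepFun_prodMk [IsProbabilityMeasure P] {ι : Type*} [Fintype ι]
    {α β : Type*} [MeasurableSpace α] [MeasurableSpace β] {U : ι → Ω → α} {Z : ι → Ω → β}
    (hU : ∀ k, Measurable (U k)) (hZ : ∀ k, Measurable (Z k))
    (hUZ : ∀ k, IndepFun (U k) (Z k) P) (hindep : iIndepFun (fun k ω => (U k ω, Z k ω)) P) :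
    IndepFun (fun ω k => U k ω) (fun ω k => Z k ω) P := by
  have hUm : Measurable fun ω k => U k ω := measurable_pi_lambda _ hU
  have hZm : Measurable fun ω k => Z k ω := measurable_pi_lambda _ hZ
  have := fun k => Measure.isProbabilityMeasure_map (μ := P) (hU k).aemeasurable
  have := fun k => Measure.isProbabilityMeasure_map (μ := P) (hZ k).aemeasurable
  rw [indepFun_iff_map_prod_eq_prod_map_map hUm.aemeasurable hZm.aemeasurable]
  have h1 := (iIndepFun_iff_map_fun_eq_pi_map fun k =>
    ((hU k).prodMk (hZ k)).aemeasurable).1 hindep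
  have hU1 := (iIndepFun_iff_map_fun_eq_pi_map fun k => (hU k).aemeasurable).1
    (hindep.comp (fun _ => Prod.fst) fun _ => measurable_fst)
  have hZ1 := (iIndepFun_iff_map_fun_eq_pi_map fun k => (hZ k).aemeasurable).1
    (hindep.comp (fun _ => Prod.snd) fun _ => measurable_snd)
  have h2 : ∀ k, P.map (fun ω => (U k ω, Z k ω)) = (P.map (U k)).prod (P.map (Z k)) := fun k =>
    (indepFun_iff_map_prod_eq_prod_map_map (hU k).aemeasurable (hZ k).aemeasurable).1 (hUZ k)
  simp_rw [h2] at h1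
  rw [hU1, hZ1, ← (measurePreserving_arrowProdEquivProdArrow α β ι (fun k => P.map (U k))
    fun k => P.map (Z k)).map_eq, ← h1, Measure.map_map (MeasurableEquiv.measurable _)
    (measurable_pi_lambda _ fun k => (hU k).prodMk (hZ k))]
  rfl

/-- A unit-norm linear form of a standard Gaussian vector is standard Gaussian. This is where the
restriction to the sphere makes the noise level independent of `w`. -/
theorem map_sum_mul_gaussianReal [IsProbabilityMeasure P] {K : ℕ} {Z : Fin K → Ω → ℝ}
    (hZ : ∀ k, Measurable (Z k)) (hZgauss : ∀ k, P.map (Z k) = gaussianReal 0 1)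
    (hindep : iIndepFun Z P) {w : EuclideanSpace ℝ (Fin K)} (hw : ‖w‖ = 1) :
    P.map (fun ω => ∑ k, w k * Z k ω) = gaussianReal 0 1 := by
  have h1 := (iIndepFun_iff_map_fun_eq_pi_map fun k => (hZ k).aemeasurable).1 hindep
  simp_rw [hZgauss] at h1
  have hm : Measurable fun ω k => Z k ω := measurable_pi_lambda _ hZ
  have h2 : P.map (fun ω => ∑ k, w k * Z k ω) =
      (stdGaussian (EuclideanSpace ℝ (Fin K))).map (innerSL ℝ w) := by
    rw [← map_pi_eq_stdGaussian, ← h1, Measure.map_map (by fun_prop) (by fun_prop),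
      Measure.map_map (by fun_prop) hm]
    congr 1
    ext ω
    simp [PiLp.inner_apply, mul_comm]
  rw [h2, IsGaussian.map_eq_gaussianReal, variance_dual_stdGaussian,
    integral_strongDual_stdGaussian]
  simp [hw]

theorem map_output_source [IsProbabilityMeasure P] {K : ℕ} {U Z : Fin K → Ω → ℝ}
    (hU : ∀ k, Measurable (U k)) (hZ : ∀ k, Measurable (Z k))
    (hZgauss : ∀ k, P.map (Z k) = gaussianReal 0 1)
    (hUZ : ∀ k, IndepFun (U k) (Z k) P) (hindep : iIndepFun (fun k ω => (U k ω, Z k ω)) P)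
    [Fintype (possibleValues P (randomVector U))]
    (hX : ∀ᵐ ω ∂P, randomVector U ω ∈ possibleValues P (randomVector U))
    {w : EuclideanSpace ℝ (Fin K)} (hw : w ∈ unitSphere K) (σ : ℝ) :
    P.map (output (source U Z σ) w) = ∑ u : possibleValues P (randomVector U),
      ENNReal.ofReal (P.real (randomVector U ⁻¹' {(u : EuclideanSpace ℝ (Fin K))})) •
        gaussianReal (inner ℝ w u) (σ ^ 2).toNNReal := by
  have hind := indepFun_pi_of_iIndepFun_prodMk hU hZ hUZ hindep
  have hXm : Measurable (randomVector U) := by unfold randomVector; fun_prop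
  have hN : Measurable fun ω => ∑ k, w k * Z k ω := by fun_prop
  have hXN : IndepFun (randomVector U) (fun ω => ∑ k, w k * Z k ω) P :=
    hind.comp (φ := WithLp.toLp 2) (ψ := fun z : Fin K → ℝ => ∑ k, w k * z k)
      (by fun_prop) (by fun_prop)
  have hout : output (source U Z σ) w = fun ω =>
      inner ℝ w (randomVector U ω) + σ * ∑ k, w k * Z k ω := by
    ext ω
    simp only [output, source, randomVector, PiLp.inner_apply, Finset.mul_sum]
    rw [← Finset.sum_add_distrib]
    refine Finset.sum_congr rfl fun k _ => ?_
    simp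
    ring
  rw [hout, map_add_mul_eq_sum hXm hX hN hXN (f := fun u => inner ℝ w u) (by fun_prop) σ,
    map_sum_mul_gaussianReal hZ hZgauss
      (hindep.comp (fun _ => Prod.snd) fun _ => measurable_snd) (by simpa [unitSphere] using hw)]
  simp_rw [gaussianReal_eq_map_std]

theorem exists_finite_ae_randomVector_mem {K : ℕ} {U : Fin K → Ω → ℝ}
    (hU : ∀ k, IsFinitelyDiscrete P (U k)) :
    ∃ G : Set (EuclideanSpace ℝ (Fin K)), G.Finite ∧ ∀ᵐ ω ∂P, randomVector U ω ∈ G := by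
  choose F hF using hU
  refine ⟨WithLp.toLp 2 '' Set.univ.pi fun k => (F k : Set ℝ),
    (Set.Finite.pi fun k => (F k).finite_toSet).image _, ?_⟩
  filter_upwards [ae_all_iff.2 hF] with ω hω
  exact ⟨_, fun k _ => hω k, rfl⟩

theorem mem_possibleValues_randomVector {K : ℕ} {U : Fin K → Ω → ℝ} (hindep : iIndepFun U P)
    {u : EuclideanSpace ℝ (Fin K)} (hu : ∀ k, u k ∈ possibleValues P (U k)) :
    u ∈ possibleValues P (randomVector U) := by
  have h := hindep.meas_iInter (s := fun k => U k ⁻¹' {u k})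
    fun k => ⟨_, measurableSet_singleton _, rfl⟩
  have hset : randomVector U ⁻¹' {u} = ⋂ k, U k ⁻¹' {u k} := by
    ext ω
    simp only [randomVector, Set.mem_preimage, Set.mem_singleton_iff, Set.mem_iInter]
    refine ⟨fun h k => by rw [← h], fun h => ?_⟩
    ext k
    exact h k
  change P _ ≠ 0
  rw [hset, h]
  exact Finset.prod_ne_zero_iff.2 fun k _ => hu k

end

/-! ### Small-noise comparison of mixtures -/

section
variable {ι : Type*} [Fintype ι] {q : ι → ℝ}

theorem sum_log_le_mixtureLogRatio (hq : ∀ j, 0 < q j) (hq1 : ∑ j, q j = 1) (x : ι → ℝ) :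
    ∑ i, q i * Real.log (∑ j with x i = x j, q j) ≤ mixtureLogRatio q x :=
  Finset.sum_le_sum fun i _ => mul_le_mul_of_nonneg_left
    (log_sum_filter_le_integral_log_mixtureRatio hq hq1 i) (hq i).le

theorem tendsto_exp_neg_div_sq {δ : ℝ} (hδ : 0 < δ) (M : ℝ) :
    Tendsto (fun σ : ℝ => M * Real.exp (-(δ / σ) ^ 2 / 8)) (𝓝[>] 0) (𝓝 0) := by
  have h1 : Tendsto (fun σ : ℝ => δ / σ) (𝓝[>] 0) atTop :=
    tendsto_inv_nhdsGT_zero.const_mul_atTop hδ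
  have h2 : Tendsto (fun σ : ℝ => -(δ / σ) ^ 2 / 8) (𝓝[>] 0) atBot := by
    have := tendsto_neg_atTop_atBot.comp
      (((tendsto_pow_atTop two_ne_zero).comp h1).atTop_div_const (show (0 : ℝ) < 8 by norm_num))
    refine this.congr fun σ => ?_
    simp [neg_div]
  simpa using (Real.tendsto_exp_atBot.comp h2).const_mul M

/-- If the components with distinct `z` are far apart, and two components with equal `z` are far
apart, then the mixture is more spread out than when the components with equal `z` coincide. -/
theorem eventually_mixtureLogRatio_lt (hq : ∀ j, 0 < q j) (hq1 : ∑ j, q j = 1) (z : ι → ℝ) {δ : ℝ}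
    (hδ : 0 < δ) : ∀ᶠ σ in 𝓝[>] (0 : ℝ), ∀ x : ι → ℝ,
      (∀ i j, z i ≠ z j → δ ≤ |x i - x j|) → (∃ i j, z i = z j ∧ δ ≤ |x i - x j|) →
      mixtureLogRatio q (fun j => x j / σ) < ∑ i, q i * Real.log (∑ j with z i = z j, q j) := by
  classical
  set L : ι → ℝ := fun i => ∑ j with z i = z j, q j with hL
  have hLsplit : ∀ i j, z i = z j → L i = q j + ∑ k ∈ (Finset.univ.filter
      fun k => z i = z k).erase j, q k := fun i j h =>
    (Finset.add_sum_erase _ q (by simpa using h)).symm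
  -- `κ i j` is the loss when component `i` no longer sees the weight `q j` of its class.
  set κ : ι → ι → ℝ := fun i j => q i * (Real.log (L i) - Real.log (L i - q j)) with hκ
  set M : ℝ := ∑ i, q i * (2 * ∑ j, √(q j / q i)) with hM
  have hlim := tendsto_exp_neg_div_sq hδ M
  have hev : ∀ᶠ σ in 𝓝[>] (0 : ℝ), ∀ i j, 0 < κ i j → M * Real.exp (-(δ / σ) ^ 2 / 8) < κ i j :=
    eventually_all.2 fun i => eventually_all.2 fun j => by
      by_cases h : 0 < κ i j
      · filter_upwards [hlim.eventually (gt_mem_nhds h)] with σ hσ _ using hσ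
      · exact Eventually.of_forall fun _ h' => (h h').elim
  filter_upwards [hev, self_mem_nhdsWithin] with σ hσ hσ0 x hfar hex
  have hσ0 : 0 < σ := hσ0
  obtain ⟨i, j, hij, hδij⟩ := hex
  -- `N k` collects the components that are still `δ`-close to `k`. Separation of classes keeps it
  -- inside the class of `k`, and the split pair removes `j` from `N i`.
  set N : ι → Finset ι := fun k => Finset.univ.filter fun l => |x k - x l| < δ with hN
  have hself : ∀ k, k ∈ N k := fun k => by simp [hN, hδ]
  have hsub : ∀ k, N k ⊆ Finset.univ.filter fun l => z k = z l := fun k l hl => by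
    simp only [hN, Finset.mem_filter, Finset.mem_univ, true_and] at hl ⊢
    by_contra h
    exact (hfar k l h).not_gt hl
  have hsubi : N i ⊆ (Finset.univ.filter fun l => z i = z l).erase j := fun l hl => by
    refine Finset.mem_erase.2 ⟨?_, hsub i hl⟩
    rintro rfl
    simp only [hN, Finset.mem_filter, Finset.mem_univ, true_and] at hl
    exact hδij.not_gt hl
  have hNpos : ∀ k, 0 < ∑ l ∈ N k, q l := fun k =>
    (hq k).trans_le (Finset.single_le_sum (f := q) (fun j _ => (hq j).le) (hself k))
  have hNle : ∀ k, ∑ l ∈ N k, q l ≤ L k := fun k =>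
    Finset.sum_le_sum_of_subset_of_nonneg (hsub k) fun l _ _ => (hq l).le
  have hNi : ∑ l ∈ N i, q l ≤ L i - q j := by
    have := Finset.sum_le_sum_of_subset_of_nonneg hsubi fun l _ _ => (hq l).le
    have := hLsplit i j hij
    linarith
  have hκpos : 0 < κ i j := by
    refine mul_pos (hq i) (sub_pos.2 (Real.log_lt_log ((hNpos i).trans_le hNi) ?_))
    have := hq j
    linarith
  have hfarle : ∀ k, ∑ l ∈ (N k)ᶜ, √(q l / q k) * Real.exp (-(x k / σ - x l / σ) ^ 2 / 8) ≤
      (∑ l, √(q l / q k)) * Real.exp (-(δ / σ) ^ 2 / 8) := fun k => by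
    rw [Finset.sum_mul]
    refine (Finset.sum_le_sum fun l hl => ?_).trans (Finset.sum_le_sum_of_subset_of_nonneg
      (Finset.subset_univ _) fun l _ _ => mul_nonneg (Real.sqrt_nonneg _) (Real.exp_pos _).le)
    refine mul_le_mul_of_nonneg_left (Real.exp_le_exp.2 ?_) (Real.sqrt_nonneg _)
    simp only [hN, Finset.mem_compl, Finset.mem_filter, Finset.mem_univ, true_and, not_lt] at hl
    rw [← sub_div]
    have : (δ / σ) ^ 2 ≤ ((x k - x l) / σ) ^ 2 := by
      rw [div_pow, div_pow]
      refine div_le_div_of_nonneg_right ?_ (by positivity)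
      rw [← sq_abs (x k - x l)]
      exact pow_le_pow_left₀ hδ.le hl 2
    linarith
  have hterm : ∀ k, q k * ∫ t, Real.log (mixtureRatio q (fun j => x j / σ) k t) ∂gaussianReal 0 1 ≤
      q k * Real.log (L k) + (q k * (2 * ∑ l, √(q l / q k))) * Real.exp (-(δ / σ) ^ 2 / 8) -
        if k = i then κ i j else 0 := fun k => by
    have h1 := integral_log_mixtureRatio_le (x := fun j => x j / σ) hq hq1 k (N k) (hself k)
    have h2 := hfarle k
    have h3 : q k * Real.log (∑ l ∈ N k, q l) ≤
        q k * Real.log (L k) - if k = i then κ i j else 0 := by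
      split_ifs with hk
      · subst hk
        have := mul_le_mul_of_nonneg_left (Real.log_le_log (hNpos k) hNi) (hq k).le
        simp only [hκ]
        linarith
      · rw [sub_zero]
        exact mul_le_mul_of_nonneg_left (Real.log_le_log (hNpos k) (hNle k)) (hq k).le
    have h4 := mul_le_mul_of_nonneg_left (h1.trans
      (add_le_add_right (mul_le_mul_of_nonneg_left h2 zero_le_two) _)) (hq k).le
    linarith
  have hsum := Finset.sum_le_sum fun k (_ : k ∈ Finset.univ) => hterm k
  rw [Finset.sum_sub_distrib, Finset.sum_add_distrib, ← Finset.sum_mul, ← hM,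
    Finset.sum_ite_eq' Finset.univ i fun _ => κ i j, if_pos (Finset.mem_univ i)] at hsum
  have := hσ i j hκpos
  rw [mixtureLogRatio]
  linarith

end

/-! ### Local minima from a strict comparison -/

/-- Take a minimiser over the compact set `S ∩ closedBall z r`. By `hlt` it cannot be at distance `≥
ε` from `z`: small `ε` gives convergence, and `ε = r` keeps it off the boundary of the ball. -/
theorem exists_tendsto_isLocalMinOn {E : Type*} [MetricSpace E] [ProperSpace E] {S : Set E}
    (hS : IsClosed S) {f : ℝ → E → ℝ} (hf : ∀ σ, 0 < σ → ContinuousOn (f σ) S) {z : E} (hz : z ∈ S)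
    {r : ℝ} (hr : 0 < r) (hlt : ∀ ε, 0 < ε → ∀ᶠ σ in 𝓝[>] (0 : ℝ), ∀ w ∈ S, ε ≤ dist w z →
      dist w z ≤ r → f σ z < f σ w) :
    ∃ m : ℝ → E, (∀ᶠ σ in 𝓝[>] (0 : ℝ), m σ ∈ S ∧ IsLocalMinOn (f σ) S (m σ)) ∧
      Tendsto m (𝓝[>] (0 : ℝ)) (𝓝 z) := by
  have hcomp : IsCompact (S ∩ Metric.closedBall z r) := (isCompact_closedBall z r).inter_left hS
  have hzB : z ∈ S ∩ Metric.closedBall z r := ⟨hz, Metric.mem_closedBall_self hr.le⟩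
  have hex : ∀ σ, ∃ w, 0 < σ → w ∈ S ∩ Metric.closedBall z r ∧
      IsMinOn (f σ) (S ∩ Metric.closedBall z r) w := fun σ => by
    by_cases hσ : 0 < σ
    · obtain ⟨w, hw⟩ := hcomp.exists_isMinOn ⟨z, hzB⟩ ((hf σ hσ).mono Set.inter_subset_left)
      exact ⟨w, fun _ => hw⟩
    · exact ⟨z, fun h => (hσ h).elim⟩
  choose m hm using hex
  have hdist : ∀ ε, 0 < ε → ∀ᶠ σ in 𝓝[>] (0 : ℝ), dist (m σ) z < ε := fun ε hε => by
    filter_upwards [hlt ε hε, self_mem_nhdsWithin] with σ h hσ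
    by_contra hd
    obtain ⟨hmem, hmin⟩ := hm σ hσ
    exact (h _ hmem.1 (not_lt.1 hd) hmem.2).not_ge (hmin hzB)
  refine ⟨m, ?_, Metric.tendsto_nhds.2 hdist⟩
  filter_upwards [hdist r hr, self_mem_nhdsWithin] with σ hd hσ
  obtain ⟨hmem, hmin⟩ := hm σ hσ
  refine ⟨hmem.1, ?_⟩
  filter_upwards [self_mem_nhdsWithin, mem_nhdsWithin_of_mem_nhds
    (Metric.isOpen_ball.mem_nhds (Metric.mem_ball.2 hd))] with w hwS hwB
  exact hmin ⟨hwS, Metric.ball_subset_closedBall hwB⟩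

/-! ### Separation of projections -/

section
variable {E : Type*} [NormedAddCommGroup E] [InnerProductSpace ℝ E]

theorem exists_pos_eventually_le_abs_inner_sub {ι : Type*} [Finite ι] (x : ι → E) (w : E) :
    ∃ δ > 0, ∀ᶠ w' in 𝓝 w, ∀ i j, inner ℝ w (x i) ≠ inner ℝ w (x j) →
      δ ≤ |inner ℝ w' (x i) - inner ℝ w' (x j)| := by
  have h1 : ∀ᶠ δ in 𝓝[>] (0 : ℝ), ∀ i j, inner ℝ w (x i) ≠ inner ℝ w (x j) →
      δ < |inner ℝ w (x i) - inner ℝ w (x j)| :=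
    eventually_all.2 fun i => eventually_all.2 fun j => by
      by_cases h : inner ℝ w (x i) = inner ℝ w (x j)
      · exact Eventually.of_forall fun _ h' => (h' h).elim
      · filter_upwards [mem_nhdsWithin_of_mem_nhds
          (gt_mem_nhds (abs_pos.2 (sub_ne_zero.2 h)))] with δ hδ _ using hδ
  obtain ⟨δ, hδ, hδ0⟩ := (h1.and self_mem_nhdsWithin).exists
  refine ⟨δ, hδ0, eventually_all.2 fun i => eventually_all.2 fun j => ?_⟩
  by_cases h : inner ℝ w (x i) = inner ℝ w (x j)
  · exact Eventually.of_forall fun _ h' => (h' h).elim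
  · have hc : Continuous fun w' : E => |inner ℝ w' (x i) - inner ℝ w' (x j)| := by fun_prop
    filter_upwards [hc.continuousAt.eventually (lt_mem_nhds (hδ i j h))] with w' hw' _
    exact hw'.le

/-- The pair that `w` splits varies with `w`, but near each point one pair and one `δ` work.
Compactness then reduces to a minimum of finitely many `δ`. -/
theorem exists_pos_forall_le_abs_inner_sub {ι : Type*} [Finite ι] (x : ι → E) {z : E} {A : Set E}
    (hA : IsCompact A)
    (hne : ∀ w ∈ A, ∀ i j, inner ℝ z (x i) ≠ inner ℝ z (x j) → inner ℝ w (x i) ≠ inner ℝ w (x j))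
    (hex : ∀ w ∈ A, ∃ i j, inner ℝ z (x i) = inner ℝ z (x j) ∧
      inner ℝ w (x i) ≠ inner ℝ w (x j)) :
    ∃ δ > 0, ∀ w ∈ A,
      (∀ i j, inner ℝ z (x i) ≠ inner ℝ z (x j) → δ ≤ |inner ℝ w (x i) - inner ℝ w (x j)|) ∧
      ∃ i j, inner ℝ z (x i) = inner ℝ z (x j) ∧ δ ≤ |inner ℝ w (x i) - inner ℝ w (x j)| := by
  refine hA.induction_on (p := fun B => ∃ δ > 0, ∀ w ∈ B,
    (∀ i j, inner ℝ z (x i) ≠ inner ℝ z (x j) → δ ≤ |inner ℝ w (x i) - inner ℝ w (x j)|) ∧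
      ∃ i j, inner ℝ z (x i) = inner ℝ z (x j) ∧ δ ≤ |inner ℝ w (x i) - inner ℝ w (x j)|)
    ⟨1, one_pos, fun w hw => hw.elim⟩ ?_ ?_ ?_
  · rintro s t hst ⟨δ, hδ, h⟩
    exact ⟨δ, hδ, fun w hw => h w (hst hw)⟩
  · rintro s t ⟨δ, hδ, h⟩ ⟨δ', hδ', h'⟩
    refine ⟨min δ δ', lt_min hδ hδ', ?_⟩
    rintro w (hw | hw)
    · obtain ⟨h1, i, j, hij, h2⟩ := h w hw
      exact ⟨fun i j hij => (min_le_left _ _).trans (h1 i j hij), i, j, hij,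
        (min_le_left _ _).trans h2⟩
    · obtain ⟨h1, i, j, hij, h2⟩ := h' w hw
      exact ⟨fun i j hij => (min_le_right _ _).trans (h1 i j hij), i, j, hij,
        (min_le_right _ _).trans h2⟩
  · intro w hw
    obtain ⟨δ, hδ, h⟩ := exists_pos_eventually_le_abs_inner_sub x w
    refine ⟨_, mem_nhdsWithin_of_mem_nhds h, δ, hδ, fun w' hw' => ?_⟩
    obtain ⟨i, j, hij, hij'⟩ := hex w hw
    exact ⟨fun i j hij => hw' i j (hne w hw i j hij), i, j, hij, hw' i j hij'⟩

theorem continuousOn_mixtureLogRatio_inner {ι : Type*} [Fintype ι] {q : ι → ℝ} (hq : ∀ j, 0 < q j)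
    (hq1 : ∑ j, q j = 1) (x : ι → E) {σ : ℝ} (hσ : 0 < σ) :
    ContinuousOn (fun w => mixtureLogRatio q fun j => inner ℝ w (x j) / σ)
      (Metric.sphere (0 : E) 1) := by
  refine continuousOn_mixtureLogRatio hq hq1 (D := ∑ i, ∑ j, ‖x i - x j‖ / σ)
    (fun j => Continuous.continuousOn (by fun_prop)) fun w hw i j => ?_
  calc |inner ℝ w (x i) / σ - inner ℝ w (x j) / σ| ≤ ‖x i - x j‖ / σ := by
        rw [← sub_div, ← inner_sub_right, abs_div, abs_of_pos hσ]
        have := abs_real_inner_le_norm w (x i - x j)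
        rw [mem_sphere_zero_iff_norm.1 hw, one_mul] at this
        exact div_le_div_of_nonneg_right this hσ.le
    _ ≤ ∑ j, ‖x i - x j‖ / σ := Finset.single_le_sum (f := fun j => ‖x i - x j‖ / σ)
        (fun _ _ => by positivity) (Finset.mem_univ j)
    _ ≤ _ := Finset.single_le_sum (f := fun i => ∑ j, ‖x i - x j‖ / σ)
        (fun _ _ => by positivity) (Finset.mem_univ i)

/-- The merged-weight sum at `z` separates the two sides: it is a lower bound at `z` for every `σ >
0`, and a strict upper bound on all of `A` once `σ` is small. -/
theorem eventually_mixtureLogRatio_inner_lt {ι : Type*} [Fintype ι] {q : ι → ℝ}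
    (hq : ∀ j, 0 < q j) (hq1 : ∑ j, q j = 1) (x : ι → E) {z : E} {A : Set E} (hA : IsCompact A)
    (hne : ∀ w ∈ A, ∀ i j, inner ℝ z (x i) ≠ inner ℝ z (x j) → inner ℝ w (x i) ≠ inner ℝ w (x j))
    (hex : ∀ w ∈ A, ∃ i j, inner ℝ z (x i) = inner ℝ z (x j) ∧
      inner ℝ w (x i) ≠ inner ℝ w (x j)) :
    ∀ᶠ σ in 𝓝[>] (0 : ℝ), ∀ w ∈ A, mixtureLogRatio q (fun j => inner ℝ w (x j) / σ) <
      mixtureLogRatio q fun j => inner ℝ z (x j) / σ := by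
  obtain ⟨δ, hδ, hsep⟩ := exists_pos_forall_le_abs_inner_sub x hA hne hex
  filter_upwards [eventually_mixtureLogRatio_lt hq hq1 (fun j => inner ℝ z (x j)) hδ,
    self_mem_nhdsWithin] with σ hlt hσ w hw
  have hσ : 0 < σ := hσ
  refine (hlt _ (hsep w hw).1 (hsep w hw).2).trans_le ?_
  have := sum_log_le_mixtureLogRatio hq hq1 fun j => inner ℝ z (x j) / σ
  simpa only [div_left_inj' hσ.ne'] using this

theorem eq_or_eq_neg_of_mem_orthogonal [FiniteDimensional ℝ E] {V : Submodule ℝ E}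
    (hV : Module.finrank ℝ V + 1 = Module.finrank ℝ E) {w z : E} (hw : w ∈ Vᗮ) (hz : z ∈ Vᗮ)
    (hw1 : ‖w‖ = 1) (hz1 : ‖z‖ = 1) : w = z ∨ w = -z := by
  have h1 : Module.finrank ℝ Vᗮ = 1 := by
    have := V.finrank_add_finrank_orthogonal
    omega
  have hz0 : (⟨z, hz⟩ : Vᗮ) ≠ 0 := fun h => by
    have : z = 0 := congrArg Subtype.val h
    simp [this] at hz1
  obtain ⟨c, hc⟩ := (finrank_eq_one_iff_of_nonzero' _ hz0).1 h1 ⟨w, hw⟩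
  have hc' : c • z = w := congrArg Subtype.val hc
  rw [← hc', norm_smul, hz1, mul_one, Real.norm_eq_abs] at hw1
  rcases (abs_eq one_pos.le).1 hw1 with rfl | rfl
  · left; rw [← hc', one_smul]
  · right; rw [← hc', neg_one_smul]

end

/-! ### Directions orthogonal to differences of values -/

section
variable {Ω : Type*} [MeasurableSpace Ω] {P : Measure Ω} {K : ℕ} {U Z : Fin K → Ω → ℝ}

theorem exists_radius_of_isOrthogonalToDifferences [Finite (possibleValues P (randomVector U))]
    {z : EuclideanSpace ℝ (Fin K)} (hz : IsOrthogonalToDifferences P U z) :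
    ∃ r > 0, ∀ w ∈ unitSphere K, dist w z ≤ r →
      (∀ u v : possibleValues P (randomVector U), inner ℝ z (u : EuclideanSpace ℝ (Fin K)) ≠
        inner ℝ z (v : EuclideanSpace ℝ (Fin K)) → inner ℝ w (u : EuclideanSpace ℝ (Fin K)) ≠
        inner ℝ w (v : EuclideanSpace ℝ (Fin K))) ∧
      (w ≠ z → ∃ u v : possibleValues P (randomVector U),
        inner ℝ z (u : EuclideanSpace ℝ (Fin K)) = inner ℝ z (v : EuclideanSpace ℝ (Fin K)) ∧
        inner ℝ w (u : EuclideanSpace ℝ (Fin K)) ≠ inner ℝ w (v : EuclideanSpace ℝ (Fin K))) := by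
  obtain ⟨r, C, c, -, hC, -, -, hc, hdim, hzS, hzV⟩ := hz
  have hz1 : ‖z‖ = 1 := by simpa [unitSphere] using hzS
  obtain ⟨δ, hδ, hev⟩ := exists_pos_eventually_le_abs_inner_sub
    (fun u : possibleValues P (randomVector U) => (u : EuclideanSpace ℝ (Fin K))) z
  obtain ⟨ρ, hρ, hball⟩ := Metric.eventually_nhds_iff.1 hev
  -- The radius `ρ / 2` preserves the separations at `z`; the radius `1` excludes the antipode `-z`,
  -- at distance `2`.
  refine ⟨min (ρ / 2) 1, by positivity, fun w hw hd => ⟨fun u v huv h => ?_, fun hwz => ?_⟩⟩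
  · have := hball (lt_of_le_of_lt (hd.trans (min_le_left _ _)) (half_lt_self hρ)) u v huv
    rw [h, sub_self, abs_zero] at this
    exact this.not_gt hδ
  · by_contra! hcon
    have hw1 : ‖w‖ = 1 := by simpa [unitSphere] using hw
    have hwV : w ∈ (differenceSpan C c)ᗮ := by
      rw [differenceSpan, Submodule.mem_orthogonal]
      intro v hv
      induction hv using Submodule.span_induction with
      | mem v hv =>
        obtain ⟨i, u, hu, rfl⟩ := Set.mem_iUnion.1 hv
        have h0 := hzV (u - c i) (Submodule.subset_span (Set.mem_iUnion.2 ⟨i, u, hu, rfl⟩))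
        rw [inner_sub_right, sub_eq_zero] at h0
        have := hcon ⟨u, hC i hu.1⟩ ⟨c i, hC i (hc i)⟩ h0
        rw [real_inner_comm, inner_sub_right, sub_eq_zero]
        exact this
      | zero => simp
      | add u v _ _ hu hv => rw [inner_add_left, hu, hv, add_zero]
      | smul a u _ hu => rw [inner_smul_left, hu, mul_zero]
    have hzV' : z ∈ (differenceSpan C c)ᗮ := (Submodule.mem_orthogonal' _ _).2 hzV
    rcases eq_or_eq_neg_of_mem_orthogonal (by simpa using hdim) hwV hzV' hw1 hz1 with h | h
    · exact hwz h
    · have h2 : dist w z = 2 := by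
        rw [h, dist_eq_norm, ← neg_add', norm_neg, ← two_smul ℝ z, norm_smul, hz1]; norm_num
      have := hd.trans (min_le_right _ _)
      rw [h2] at this
      norm_num at this

/-- With two values `a k`, `b k` of each `U k`, the points obtained from `a` by changing one
coordinate `k` to `b k` are possible values by independence. They lie on a common hyperplane with
normal `((b k - a k)⁻¹)`, which has no zero coordinate. One class `C` made of these `K` points
suffices. -/
theorem exists_isOrthogonalToDifferences_ne_zero (hindep : iIndepFun U P) (hK : 2 ≤ K)
    (hval : ∀ k, (possibleValues P (U k)).Nontrivial) :
    ∃ z : EuclideanSpace ℝ (Fin K), IsOrthogonalToDifferences P U z ∧ ∀ k, z k ≠ 0 := by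
  choose a ha b hb hab using hval
  set d : Fin K → ℝ := fun k => b k - a k with hd
  have hd0 : ∀ k, d k ≠ 0 := fun k => sub_ne_zero.2 (hab k).symm
  set p : Fin K → EuclideanSpace ℝ (Fin K) := fun k =>
    WithLp.toLp 2 a + d k • EuclideanSpace.single k 1 with hp
  set g : EuclideanSpace ℝ (Fin K) := WithLp.toLp 2 fun k => (d k)⁻¹ with hg
  have hinner : ∀ x k, inner ℝ x (p k) = inner ℝ x (WithLp.toLp 2 a) + d k * x k := fun x k => by
    simp [hp, inner_add_right, inner_smul_right, EuclideanSpace.inner_single_right]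
  let k₀ : Fin K := ⟨0, by omega⟩
  let k₁ : Fin K := ⟨1, by omega⟩
  have hk : k₁ ≠ k₀ := by simp [k₀, k₁]
  have hpp : p k₁ ≠ p k₀ := fun h => by
    have := congrArg (fun v : EuclideanSpace ℝ (Fin K) => v k₀) h
    exact hd0 k₀ (by simpa [hp, hk.symm] using this)
  have hmem : ∀ k, p k ∈ possibleValues P (randomVector U) := fun k =>
    mem_possibleValues_randomVector hindep fun j => by
      by_cases hj : j = k
      · subst hj
        simpa [hp, hd] using hb j
      · simpa [hp, hj] using ha j
  have hg0 : g ≠ 0 := fun h => by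
    have := congrArg (fun v : EuclideanSpace ℝ (Fin K) => v k₀) h
    exact inv_ne_zero (hd0 k₀) (by simpa [hg] using this)
  set C : Fin 1 → Set (EuclideanSpace ℝ (Fin K)) := fun _ => Set.range p
  set c : Fin 1 → EuclideanSpace ℝ (Fin K) := fun _ => p k₀
  have hgV : ∀ v ∈ differenceSpan C c, inner ℝ g v = 0 := by
    intro v hv
    rw [differenceSpan] at hv
    induction hv using Submodule.span_induction with
    | mem v hv =>
      obtain ⟨i, _, ⟨⟨k, rfl⟩, -⟩, rfl⟩ := Set.mem_iUnion.1 hv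
      change inner ℝ g (p k - p k₀) = 0
      rw [inner_sub_right, hinner, hinner]
      simp [hg, hd0]
    | zero => simp
    | add u v _ _ hu hv => rw [inner_add_right, hu, hv, add_zero]
    | smul a u _ hu => rw [inner_smul_right, hu, mul_zero]
  -- The dimension `K - 1` is read off the orthogonal complement: orthogonality to all differences
  -- makes `d k * x k` constant in `k`, so `x` is a multiple of `g`.
  have horth : (differenceSpan C c)ᗮ = Submodule.span ℝ {g} := by
    refine le_antisymm (fun x hx => ?_) ?_
    · rw [Submodule.mem_orthogonal'] at hx
      have hx' : ∀ k, d k * x k = d k₀ * x k₀ := fun k => by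
        by_cases hk : p k = p k₀
        · have := hinner x k
          rw [hk, hinner x k₀] at this
          linarith
        · have := hx (p k - p k₀) (Submodule.subset_span
            (Set.mem_iUnion.2 ⟨0, p k, ⟨⟨k, rfl⟩, hk⟩, rfl⟩))
          rw [inner_sub_right, hinner, hinner] at this
          linarith
      refine Submodule.mem_span_singleton.2 ⟨d k₀ * x k₀, ?_⟩
      ext k
      rw [← hx' k]
      simp only [hg, PiLp.smul_apply, smul_eq_mul]
      field_simp [hd0 k]
    · rw [Submodule.span_singleton_le_iff_mem, Submodule.mem_orthogonal']
      exact hgV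
  have hdim : Module.finrank ℝ (differenceSpan C c) + 1 = K := by
    have := (differenceSpan C c).finrank_add_finrank_orthogonal
    rwa [horth, finrank_span_singleton hg0, finrank_euclideanSpace_fin] at this
  have hgn : ‖g‖⁻¹ ≠ 0 := inv_ne_zero (norm_ne_zero_iff.2 hg0)
  refine ⟨‖g‖⁻¹ • g, ⟨1, C, c, le_rfl, fun _ => ?_, fun i j hij => (hij (Subsingleton.elim _ _)).elim,
    fun _ => ⟨p k₁, ⟨k₁, rfl⟩, p k₀, ⟨k₀, rfl⟩, hpp⟩, fun _ => ⟨k₀, rfl⟩, hdim, ?_, ?_⟩, ?_⟩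
  · rintro _ ⟨k, rfl⟩
    exact hmem k
  · rw [unitSphere, mem_sphere_zero_iff_norm, norm_smul, norm_inv, norm_norm,
      inv_mul_cancel₀ (norm_ne_zero_iff.2 hg0)]
  · intro v hv
    rw [real_inner_smul_left, hgV v hv, mul_zero]
  · intro k
    exact mul_ne_zero hgn (inv_ne_zero (hd0 k))

theorem isMixing_of_forall_ne_zero (hK : 2 ≤ K) {w : EuclideanSpace ℝ (Fin K)}
    (hw : ∀ k, w k ≠ 0) : IsMixing w := by
  rintro j a rfl
  have : Nontrivial (Fin K) := Fin.nontrivial_iff_two_le.2 hK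
  obtain ⟨k, hk⟩ := exists_ne j
  exact hw k (by simp [hk])

end

/-! ### The main theorem -/

theorem lemma3 {Ω : Type*} [MeasurableSpace Ω] (P : Measure Ω) [IsProbabilityMeasure P]
    (K : ℕ) (U Z : Fin K → Ω → ℝ)
    (hU : ∀ k, Measurable (U k)) (hUdiscrete : ∀ k, IsFinitelyDiscrete P (U k))
    (hZ : ∀ k, Measurable (Z k)) (hZgauss : ∀ k, P.map (Z k) = gaussianReal 0 1)
    (hUZ : ∀ k, IndepFun (U k) (Z k) P)
    (hindep : iIndepFun (fun k ω => (U k ω, Z k ω)) P) :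
    -- the entropy is well defined on the whole unit sphere
    (∀ σ : ℝ, 0 < σ → ∀ w ∈ unitSphere K,
      HasDifferentialEntropy P (output (source U Z σ) w)) ∧
    -- local minimum points for small `σ`, converging to `wstar`
    (∀ wstar : EuclideanSpace ℝ (Fin K), IsOrthogonalToDifferences P U wstar →
      ∃ m : ℝ → EuclideanSpace ℝ (Fin K),
        (∀ᶠ σ in 𝓝[>] (0 : ℝ), IsEntropyLocalMin P U Z σ (m σ)) ∧
        Tendsto m (𝓝[>] (0 : ℝ)) (𝓝 wstar)) ∧
    -- existence of mixing local minimum points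
    (2 ≤ K → (∀ k, (possibleValues P (U k)).Nontrivial) →
      ∃ wstar : EuclideanSpace ℝ (Fin K), IsOrthogonalToDifferences P U wstar ∧ IsMixing wstar ∧
        ∃ m : ℝ → EuclideanSpace ℝ (Fin K),
          (∀ᶠ σ in 𝓝[>] (0 : ℝ), IsEntropyLocalMin P U Z σ (m σ) ∧ IsMixing (m σ)) ∧
          Tendsto m (𝓝[>] (0 : ℝ)) (𝓝 wstar)) := by

  classical
  obtain ⟨G, hGfin, hG⟩ := exists_finite_ae_randomVector_mem hUdiscrete
  have hX := ae_mem_possibleValues hGfin hG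
  have hfin : Finite (possibleValues P (randomVector U)) :=
    (hGfin.subset (possibleValues_subset hG)).to_subtype
  let _ : Fintype (possibleValues P (randomVector U)) := Fintype.ofFinite _
  have hXm : Measurable (randomVector U) := by unfold randomVector; fun_prop
  set ι := possibleValues P (randomVector U)
  set q : ι → ℝ := fun u => P.real (randomVector U ⁻¹' {(u : EuclideanSpace ℝ (Fin K))}) with hqdef
  have hq : ∀ u, 0 < q u := fun u => measureReal_nonneg.lt_of_ne'
    ((measureReal_ne_zero_iff (measure_ne_top _ _)).2 u.2)
  have hq1 : ∑ u, q u = 1 := sum_measureReal_possibleValues hXm hX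
  have hlaw : ∀ σ, ∀ w ∈ unitSphere K, P.map (output (source U Z σ) w) =
      ∑ u : ι, ENNReal.ofReal (q u) •
        gaussianReal (inner ℝ w (u : EuclideanSpace ℝ (Fin K))) (σ ^ 2).toNNReal :=
    fun σ w hw => map_output_source hU hZ hZgauss hUZ hindep hX hw σ
  have hH : ∀ σ, 0 < σ → ∀ w ∈ unitSphere K, differentialEntropy P (output (source U Z σ) w) =
      Real.log √(2 * Real.pi * σ ^ 2) + ∫ t, t ^ 2 / 2 ∂gaussianReal 0 1 -
        mixtureLogRatio q fun u : ι => inner ℝ w (u : EuclideanSpace ℝ (Fin K)) / σ :=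
    fun σ hσ w hw => differentialEntropy_of_map_eq_sum_gaussianReal hq hq1 hσ (hlaw σ w hw)
  have hmain : ∀ z : EuclideanSpace ℝ (Fin K), IsOrthogonalToDifferences P U z →
      ∃ m : ℝ → EuclideanSpace ℝ (Fin K),
        (∀ᶠ σ in 𝓝[>] (0 : ℝ), IsEntropyLocalMin P U Z σ (m σ)) ∧
        Tendsto m (𝓝[>] (0 : ℝ)) (𝓝 z) := by
    intro z hz
    obtain ⟨r, hr, hrad⟩ := exists_radius_of_isOrthogonalToDifferences hz
    obtain ⟨-, -, -, -, -, -, -, -, -, hzS, -⟩ := hz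
    refine exists_tendsto_isLocalMinOn Metric.isClosed_sphere (fun σ hσ => ?_) hzS hr
      fun ε hε => ?_
    · exact (continuousOn_const.sub (continuousOn_mixtureLogRatio_inner hq hq1
        (fun u : ι => (u : EuclideanSpace ℝ (Fin K))) hσ)).congr (hH σ hσ)
    -- Removing the `ε`-ball leaves a compact piece of the sphere near `z`, where the comparison
    -- with `z` is uniform.
    · have hA : IsCompact (unitSphere K ∩ {w | ε ≤ dist w z ∧ dist w z ≤ r}) :=
        (isCompact_sphere _ _).inter_right
          (isClosed_Icc.preimage (continuous_id.dist continuous_const) :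
            IsClosed ((fun w => dist w z) ⁻¹' Set.Icc ε r))
      filter_upwards [eventually_mixtureLogRatio_inner_lt hq hq1
        (fun u : ι => (u : EuclideanSpace ℝ (Fin K))) (z := z) hA
        (fun w hw => (hrad w hw.1 hw.2.2).1)
        (fun w hw => (hrad w hw.1 hw.2.2).2 (dist_pos.1 (hε.trans_le hw.2.1))),
        self_mem_nhdsWithin] with σ hlt hσ w hw h1 h2
      rw [hH σ hσ z hzS, hH σ hσ w hw]
      exact sub_lt_sub_left (hlt w ⟨hw, h1, h2⟩) _
  refine ⟨fun σ hσ w hw => ?_, hmain, fun hK hval => ?_⟩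
  · refine hasDifferentialEntropy_of_map_eq_sum_gaussianReal hq hq1 hσ ?_ (hlaw σ w hw)
    unfold output source
    exact Measurable.aemeasurable (by fun_prop)
  · obtain ⟨z, hz, hz0⟩ := exists_isOrthogonalToDifferences_ne_zero
      (hindep.comp (fun _ => Prod.fst) fun _ => measurable_fst) hK hval
    obtain ⟨m, hm, hlim⟩ := hmain z hz
    refine ⟨z, hz, isMixing_of_forall_ne_zero hK hz0, m, ?_, hlim⟩
    -- Having no zero coordinate is an open condition, so it passes from `z` to nearby `m σ` and
    -- makes them mixing.
    have hev : ∀ᶠ w in 𝓝 z, ∀ k, w k ≠ 0 := eventually_all.2 fun k =>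
      ContinuousAt.eventually_ne (g := fun w : EuclideanSpace ℝ (Fin K) => w k)
        (by fun_prop) (hz0 k)
    filter_upwards [hm, hlim.eventually hev] with σ h1 h2
    exact ⟨h1, isMixing_of_forall_ne_zero hK h2⟩
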